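/- Let $n\ge 1$ and $1\le j\le n$ be integers. A convex body in $\mathbb R^n$ is a nonempty compact convex set (interior points are not required). Let $\omega_j$ denote the volume of the unit ball of $\mathbb R^j$, let $G_{n,j}$ be the Grassmann manifold of $j$-dimensional linear subspaces of $\mathbb R^n$ with its rotation-invariant Borel probability measure $\mu_j$, and let $\mathrm{vol}_j(K|\xi)$ be the $j$-dimensional volume of the orthogonal projection of $K$ onto $\xi\in G_{n,j}$. The affine quermassintegrals of a convex body $K$ are $\Phi_0(K)=V(K)$ (the volume of $K$), $\Phi_n(K)=\omega_n$, and, for $0<j<n$, $$\Phi_{n-j}(K)=\omega_n\left[\int_{G_{n,j}}\left(\frac{\mathrm{vol}_j(K|\xi)}{\omega_j}\right)^{-n}d\mu_j(\xi)\right]^{-1/n},$$ with the conventions $0^{-n}=\infty$ and $\infty^{-1/n}=0$ (needed only for bodies with empty interior). If $K$ and $L$ are convex bodies in $\mathbb R^n$ that contain the origin, then for every $\varepsilon>0$ $$\Phi_{n-j}(K+\varepsilon L)^{1/j}\ \ge\ \Phi_{n-j}(K)^{1/j}+\varepsilon\,\Phi_{n-j}(L)^{1/j},$$ where $K+\varepsilon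 L=\{x+\varepsilon y: x\in K,\ y\in L\}$. -/

import Mathlib

open MeasureTheory
open scoped ENNReal

noncomputable section

/-- Euclidean space `ℝⁿ`. -/
abbrev Euc (n : ℕ) : Type := EuclideanSpace ℝ (Fin n)

/-- The orthogonal group `O(n)`, as the group of orthogonal operators on `ℝⁿ`, with the topology of
the operator norm. -/
abbrev OrthGroup (n : ℕ) : Type := unitary (Euc n →L[ℝ] Euc n)

instance OrthGroup.instContinuousStar (n : ℕ) : ContinuousStar (Euc n →L[ℝ] Euc n) :=
  ⟨ContinuousLinearMap.adjoint.continuous⟩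

instance OrthGroup.instCompactSpace (n : ℕ) : CompactSpace (OrthGroup n) := by
  have : ProperSpace (Euc n →L[ℝ] Euc n) := FiniteDimensional.proper ℝ _
  have hc : IsClosed (unitary (Euc n →L[ℝ] Euc n) : Set (Euc n →L[ℝ] Euc n)) := isClosed_unitary
  have hb : Bornology.IsBounded (unitary (Euc n →L[ℝ] Euc n) : Set (Euc n →L[ℝ] Euc n)) := by
    refine (Metric.isBounded_closedBall (x := 0) (r := 1)).subset fun u hu => ?_
    rw [mem_closedBall_zero_iff]
    refine ContinuousLinearMap.opNorm_le_bound _ zero_le_one fun x => ?_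
    rw [one_mul]
    exact ((Unitary.linearIsometryEquiv ⟨u, hu⟩).norm_map x).le
  exact isCompact_iff_compactSpace.mp (Metric.isCompact_of_isClosed_isBounded hc hb)

/-- The Grassmann manifold `G_{n,j}` of `j`-dimensional linear subspaces of `ℝⁿ`. -/
structure Gr (n j : ℕ) where
  /-- The underlying subspace. -/
  space : Submodule ℝ (Euc n)
  finrank_eq : Module.finrank ℝ space = j

/-- The image `g ξ` of a `j`-dimensional subspace `ξ` under `g ∈ O(n)`. -/
def Gr.rotate {n j : ℕ} (g : OrthGroup n) (ξ : Gr n j) : Gr n j :=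
  ⟨ξ.space.map (g : Euc n →L[ℝ] Euc n).toLinearMap, by
    exact ((Unitary.linearIsometryEquiv g).toLinearEquiv.finrank_map_eq ξ.space).trans ξ.finrank_eq⟩

/-- The topology of `G_{n,j}` as a homogeneous space of `O(n)`, that is, the quotient topology under
the orbit map `g ↦ g ξ₀`. Since `O(n)` acts transitively on `G_{n,j}`, all base points `ξ₀` give the
same topology; the supremum avoids choosing one. -/
instance Gr.instTopologicalSpace (n j : ℕ) : TopologicalSpace (Gr n j) :=
  ⨆ ξ₀ : Gr n j, TopologicalSpace.coinduced (fun g : OrthGroup n => Gr.rotate g ξ₀) inferInstance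

/-- `G_{n,j}` carries its Borel `σ`-algebra. -/
instance Gr.instMeasurableSpace (n j : ℕ) : MeasurableSpace (Gr n j) := borel _

instance Gr.instBorelSpace (n j : ℕ) : BorelSpace (Gr n j) := ⟨rfl⟩

theorem Gr.continuous_rotate {n j : ℕ} (ξ₀ : Gr n j) :
    Continuous fun g : OrthGroup n => Gr.rotate g ξ₀ :=
  continuous_iff_coinduced_le.mpr
    (le_iSup (fun ξ : Gr n j =>
      TopologicalSpace.coinduced (fun g : OrthGroup n => Gr.rotate g ξ) inferInstance) ξ₀)

/-- The coordinate subspace spanned by the first `j` standard basis vectors of `ℝⁿ`. -/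
def Gr.coord {n j : ℕ} (h : j ≤ n) : Gr n j :=
  ⟨Submodule.span ℝ (Set.range fun i : Fin j =>
      EuclideanSpace.basisFun (Fin n) ℝ (Fin.castLE h i)), by
    have hli : LinearIndependent ℝ fun i : Fin j =>
        EuclideanSpace.basisFun (Fin n) ℝ (Fin.castLE h i) :=
      (EuclideanSpace.basisFun (Fin n) ℝ).orthonormal.linearIndependent.comp _
        (Fin.castLE_injective h)
    rw [finrank_span_eq_card hli, Fintype.card_fin]⟩

/-- The Haar probability measure on `O(n)`. -/
def orthHaar (n : ℕ) : Measure (OrthGroup n) := Measure.haarMeasure ⊤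

/-- The Haar probability measure `μ_j` on `G_{n,j}`: the image of the Haar probability measure of
`O(n)` under an orbit map. It is the rotation invariant Borel probability measure. -/
def Gr.haar {n j : ℕ} (h : j ≤ n) : Measure (Gr n j) :=
  (orthHaar n).map fun g => Gr.rotate g (Gr.coord h)

/-- `ω_j`, the volume of the unit ball of `ℝʲ`. -/
def ballVol (j : ℕ) : ℝ≥0∞ := volume (Metric.closedBall (0 : Euc j) 1)

/-- `vol_j (K | ξ)`, the `j`-dimensional volume (Lebesgue measure of the Euclidean space `ξ`) of the
orthogonal projection of `K` onto the `j`-dimensional subspace `ξ`. -/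
def projVol {n j : ℕ} (K : ConvexBody (Euc n)) (ξ : Gr n j) : ℝ≥0∞ :=
  volume (ξ.space.orthogonalProjectionOnto '' (K : Set (Euc n)))

/-- The affine quermassintegral `Φ_{n-j}(K)` for `0 ≤ j ≤ n`, indexed by the dimension `j` of the
subspaces: `Φ_n(K) = ω_n`, `Φ_0(K) = V(K)`, and for `0 < j < n`
`Φ_{n-j}(K) = ω_n [∫_{G_{n,j}} (vol_j(K|ξ) / ω_j)^{-n} dμ_j(ξ)]^{-1/n}`.
The bracket is computed in `[0, ∞]`, where `0 ^ (-n) = ∞` and `∞ ^ (-1/n) = 0`; this matters only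
for bodies without interior points. -/
def affineQuermass {n : ℕ} (j : ℕ) (K : ConvexBody (Euc n)) : ℝ :=
  if j = 0 then (ballVol n).toReal
  else if h : j < n then
    (ballVol n *
      (∫⁻ ξ : Gr n j, (projVol K ξ / ballVol j) ^ (-(n : ℝ)) ∂(Gr.haar h.le)) ^
        (-(1 / (n : ℝ)))).toReal
  else (volume (K : Set (Euc n))).toReal

end

/-!
The affine quermassintegral `Φ_{n-j}(K)` is, up to constants, the `L^q` mean of `vol_j(K|ξ)` over
the Grassmannian for the negative exponent `q = -n`, so `Φ_{n-j}(K)^{1/j}` is the `L^{qj}` mean of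
`vol_j(K|ξ)^{1/j}`. Since `(K + L)|ξ = K|ξ + L|ξ`, the Brunn–Minkowski inequality in `ξ` makes the
latter function superadditive in `K`, and Minkowski's inequality is reversed for negative
exponents. Both inequalities have the same shape: a homogeneous log-concave functional is
superadditive. Log-concavity comes from the Prékopa–Leindler inequality in the first case and from
Hölder's inequality in the second.
-/

section MeanInequalities

theorem rpow_mul_rpow_le_add {s t : ℝ} (hs : 0 < s) (ht : 0 < t) (hst : s + t = 1) (a b : ℝ≥0∞) :
    a ^ s * b ^ t ≤ ENNReal.ofReal s * a + ENNReal.ofReal t * b := by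
  have hconj : s⁻¹.HolderConjugate t⁻¹ :=
    Real.holderConjugate_iff.2 ⟨(one_lt_inv₀ hs).2 (by linarith), by simpa using hst⟩
  have h := ENNReal.young_inequality (a ^ s) (b ^ t) hconj
  rwa [ENNReal.rpow_rpow_inv hs.ne', ENNReal.rpow_rpow_inv ht.ne', ENNReal.ofReal_inv_of_pos hs,
    ENNReal.ofReal_inv_of_pos ht, div_eq_mul_inv, div_eq_mul_inv, inv_inv,
    inv_inv, mul_comm a, mul_comm b] at h

theorem min_le_rpow_mul_rpow {s t : ℝ} (hs : 0 ≤ s) (ht : 0 ≤ t) (hst : s + t = 1) (a b : ℝ≥0∞) :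
    min a b ≤ a ^ s * b ^ t :=
  calc min a b = min a b ^ s * min a b ^ t := by
        rw [← ENNReal.rpow_add_of_nonneg _ _ hs ht, hst, ENNReal.rpow_one]
    _ ≤ a ^ s * b ^ t := by
        gcongr
        exacts [min_le_left a b, min_le_right a b]

theorem rpow_le_rpow_of_nonpos {a b : ℝ≥0∞} {q : ℝ} (hq : q ≤ 0) (hab : a ≤ b) :
    b ^ q ≤ a ^ q := by
  have h := ENNReal.inv_le_inv.2 (ENNReal.rpow_le_rpow hab (neg_nonneg.2 hq))
  simpa only [ENNReal.rpow_neg, inv_inv] using h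

theorem rpow_mul_rpow_le_mul_rpow (a b : ℝ≥0∞) (q : ℝ) : a ^ q * b ^ q ≤ (a * b) ^ q := by
  rw [ENNReal.mul_rpow_eq_ite]
  split_ifs
  exacts [le_top, le_rfl]

theorem add_rpow_le_rpow_mul_rpow {s t q : ℝ} (hs : 0 < s) (ht : 0 < t) (hst : s + t = 1)
    (hq : q < 0) (a b : ℝ≥0∞) :
    (ENNReal.ofReal s * a + ENNReal.ofReal t * b) ^ q ≤ (a ^ q) ^ s * (b ^ q) ^ t := by
  rcases eq_or_ne a ∞ with rfl | ha
  · simp [ENNReal.mul_top, hs, hq]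
  rcases eq_or_ne b ∞ with rfl | hb
  · simp [ENNReal.mul_top, ht, hq]
  calc (ENNReal.ofReal s * a + ENNReal.ofReal t * b) ^ q
      ≤ (a ^ s * b ^ t) ^ q :=
        rpow_le_rpow_of_nonpos hq.le (rpow_mul_rpow_le_add hs ht hst a b)
    _ = (a ^ q) ^ s * (b ^ q) ^ t := by
        rw [ENNReal.mul_rpow_of_ne_top (ENNReal.rpow_ne_top_of_nonneg hs.le ha)
          (ENNReal.rpow_ne_top_of_nonneg ht.le hb), ← ENNReal.rpow_mul,
          ← ENNReal.rpow_mul, mul_comm s, mul_comm t, ENNReal.rpow_mul, ENNReal.rpow_mul]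

end MeanInequalities

open scoped NNReal in
/-- After rescaling `x` and `y` to `Φ = 1`, log-concavity bounds `Φ` from below at the convex
combination that is a multiple of `x + y`. -/
theorem add_le_map_add_of_homogeneous_of_logConcave {X : Type*} [AddMonoid X]
    [DistribMulAction ℝ≥0 X] {Φ : X → ℝ≥0∞} {x y : X}
    (hsmul : ∀ c : ℝ≥0, c ≠ 0 → ∀ z, Φ (c • z) = c * Φ z)
    (hx : Φ x ≤ Φ (x + y)) (hy : Φ y ≤ Φ (x + y))
    (hlog : ∀ s t : ℝ≥0, s ≠ 0 → t ≠ 0 → s + t = 1 → ∀ c d : ℝ≥0,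
      Φ (c • x) ^ (s : ℝ) * Φ (d • y) ^ (t : ℝ) ≤ Φ (s • c • x + t • d • y)) :
    Φ x + Φ y ≤ Φ (x + y) := by
  rcases eq_or_ne (Φ x) 0 with hx0 | hx0
  · rwa [hx0, zero_add]
  rcases eq_or_ne (Φ y) 0 with hy0 | hy0
  · rwa [hy0, add_zero]
  rcases eq_or_ne (Φ x) ∞ with hxt | hxt
  · exact le_top.trans (hxt ▸ hx)
  rcases eq_or_ne (Φ y) ∞ with hyt | hyt
  · exact le_top.trans (hyt ▸ hy)
  obtain ⟨a, ha⟩ : ∃ a : ℝ≥0, a = Φ x := WithTop.ne_top_iff_exists.1 hxt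
  obtain ⟨b, hb⟩ : ∃ b : ℝ≥0, b = Φ y := WithTop.ne_top_iff_exists.1 hyt
  have ha0 : a ≠ 0 := by simpa [← ha] using hx0
  have hb0 : b ≠ 0 := by simpa [← hb] using hy0
  have hab0 : a + b ≠ 0 := by simp [ha0]
  have hnormalized {c : ℝ≥0} (hc : c ≠ 0) {z : X} (hz : (c : ℝ≥0∞) = Φ z) : Φ (c⁻¹ • z) = 1 := by
    rw [hsmul _ (inv_ne_zero hc), ← hz, ← ENNReal.coe_mul, inv_mul_cancel₀ hc, ENNReal.coe_one]
  have hcombination :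
      (a / (a + b)) • a⁻¹ • x + (b / (a + b)) • b⁻¹ • y = (a + b)⁻¹ • (x + y) := by
    rw [smul_smul, smul_smul, smul_add]
    congr 2 <;> field_simp
  have hone : 1 ≤ ((a + b)⁻¹ : ℝ≥0) * Φ (x + y) := by
    have h := hlog (a / (a + b)) (b / (a + b)) (div_ne_zero ha0 hab0) (div_ne_zero hb0 hab0)
      (by field_simp) a⁻¹ b⁻¹
    rwa [hnormalized ha0 ha, hnormalized hb0 hb, ENNReal.one_rpow, ENNReal.one_rpow, one_mul,
      hcombination, hsmul _ (inv_ne_zero hab0)] at h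
  calc Φ x + Φ y = (a + b : ℝ≥0) * 1 := by rw [← ha, ← hb, mul_one, ENNReal.coe_add]
    _ ≤ (a + b : ℝ≥0) * (((a + b)⁻¹ : ℝ≥0) * Φ (x + y)) := by gcongr
    _ = Φ (x + y) := by
        rw [← mul_assoc, ← ENNReal.coe_mul, mul_inv_cancel₀ hab0, ENNReal.coe_one, one_mul]

section NegativeExponent

variable {α : Type*} [MeasurableSpace α] {μ : Measure α} {f g h : α → ℝ≥0∞} {q : ℝ}

theorem eLpNorm'_mono_of_neg (hq : q < 0) (hfg : ∀ x, f x ≤ g x) :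
    eLpNorm' f q μ ≤ eLpNorm' g q μ :=
  rpow_le_rpow_of_nonpos (one_div_neg.2 hq).le
    (lintegral_mono fun x => rpow_le_rpow_of_nonpos hq.le (hfg x))

theorem eLpNorm'_const_mul_of_neg (hq : q < 0) {c : ℝ≥0∞} (hc₀ : c ≠ 0) (hc : c ≠ ∞) :
    eLpNorm' (fun x => c * f x) q μ = c * eLpNorm' f q μ := by
  have hcq₀ : c ^ q ≠ 0 := by simp [ENNReal.rpow_eq_zero_iff, hc₀, hc]
  have hcq : c ^ q ≠ ∞ := by simp [ENNReal.rpow_eq_top_iff, hc₀, hc]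
  have hmul {c : ℝ≥0∞} (hc₀ : c ≠ 0) (hc : c ≠ ∞) (r : ℝ) (a : ℝ≥0∞) :
      (c * a) ^ r = c ^ r * a ^ r := by
    simp [ENNReal.mul_rpow_eq_ite, hc₀, hc]
  simp only [eLpNorm', enorm_eq_self, hmul hc₀ hc]
  rw [lintegral_const_mul' _ _ hcq, hmul hcq₀ hcq, ← ENNReal.rpow_mul, mul_one_div_cancel hq.ne,
    ENNReal.rpow_one]

theorem eLpNorm'_ne_top_of_neg [NeZero μ] (hq : q < 0) (hf : Measurable f)
    (hfin : ∀ x, f x ≠ ∞) : eLpNorm' f q μ ≠ ∞ := by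
  intro htop
  have hzero : ∫⁻ x, f x ^ q ∂μ = 0 := by
    rw [eLpNorm', ENNReal.rpow_eq_top_iff] at htop
    exact (by simpa [hq.not_gt] using htop : _ ∧ q < 0).1
  rw [lintegral_eq_zero_iff (hf.pow_const q)] at hzero
  obtain ⟨x, hx⟩ := hzero.exists
  simp [ENNReal.rpow_eq_zero_iff, hq.not_gt, hfin x] at hx

theorem eLpNorm'_rpow_mul_rpow_le_of_neg (hq : q < 0) (hf : Measurable f) (hg : Measurable g)
    {s t : ℝ} (hs : 0 < s) (ht : 0 < t) (hst : s + t = 1) :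
    eLpNorm' f q μ ^ s * eLpNorm' g q μ ^ t ≤
      eLpNorm' (fun x => ENNReal.ofReal s * f x + ENNReal.ofReal t * g x) q μ := by
  have hHolder : ∫⁻ x, (ENNReal.ofReal s * f x + ENNReal.ofReal t * g x) ^ q ∂μ ≤
      (∫⁻ x, f x ^ q ∂μ) ^ s * (∫⁻ x, g x ^ q ∂μ) ^ t :=
    (lintegral_mono fun x => add_rpow_le_rpow_mul_rpow hs ht hst hq (f x) (g x)).trans
      (ENNReal.lintegral_mul_norm_pow_le (hf.pow_const q).aemeasurable
        (hg.pow_const q).aemeasurable hs.le ht.le hst)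
  simp only [eLpNorm', enorm_eq_self]
  rw [← ENNReal.rpow_mul, ← ENNReal.rpow_mul, mul_comm _ s, mul_comm _ t, ENNReal.rpow_mul,
    ENNReal.rpow_mul]
  exact (rpow_mul_rpow_le_mul_rpow _ _ _).trans
    (rpow_le_rpow_of_nonpos (one_div_neg.2 hq).le hHolder)

theorem eLpNorm'_add_le_of_neg (hq : q < 0) (hf : Measurable f) (hg : Measurable g) :
    eLpNorm' f q μ + eLpNorm' g q μ ≤ eLpNorm' (f + g) q μ := by
  refine add_le_map_add_of_homogeneous_of_logConcave (Φ := fun u : α → ℝ≥0∞ => eLpNorm' u q μ)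
    (fun c hc u => eLpNorm'_const_mul_of_neg hq (by simpa using hc) ENNReal.coe_ne_top)
    (eLpNorm'_mono_of_neg hq fun x => le_self_add) (eLpNorm'_mono_of_neg hq fun x => le_add_self)
    fun s t hs ht hst c d => ?_
  have h := eLpNorm'_rpow_mul_rpow_le_of_neg (μ := μ) hq (hf.const_smul c) (hg.const_smul d)
    (NNReal.coe_pos.2 hs.bot_lt) (NNReal.coe_pos.2 ht.bot_lt) (by exact_mod_cast hst)
  simp only [ENNReal.ofReal_coe_nnreal] at h
  exact h

theorem eLpNorm'_rpow_inv_add_le_of_neg (hq : q < 0) (hf : Measurable f) (hg : Measurable g)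
    {d : ℝ} (hd : 0 < d) (hadd : ∀ x, f x ^ d⁻¹ + g x ^ d⁻¹ ≤ h x ^ d⁻¹) :
    eLpNorm' f q μ ^ d⁻¹ + eLpNorm' g q μ ^ d⁻¹ ≤ eLpNorm' h q μ ^ d⁻¹ := by
  have hroot (u : α → ℝ≥0∞) :
      eLpNorm' u q μ ^ d⁻¹ = eLpNorm' (fun x => u x ^ d⁻¹) (q * d) μ := by
    have hpow := eLpNorm'_enorm_rpow (μ := μ) (fun x => u x ^ d⁻¹) q d hd
    simp only [enorm_eq_self, ENNReal.rpow_inv_rpow hd.ne'] at hpow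
    rw [hpow, ENNReal.rpow_rpow_inv hd.ne']
  have hqd : q * d < 0 := mul_neg_of_neg_of_pos hq hd
  simp only [hroot]
  exact (eLpNorm'_add_le_of_neg hqd (hf.pow_const _) (hg.pow_const _)).trans
    (eLpNorm'_mono_of_neg hqd hadd)

end NegativeExponent

section AddSets

open scoped Pointwise

theorem measure_le_measure_add {G : Type*} [AddGroup G] [MeasurableSpace G] {μ : Measure G}
    [μ.IsAddLeftInvariant] {A : Set G} (hA : A.Nonempty) (B : Set G) : μ B ≤ μ (A + B) := by
  obtain ⟨a, ha⟩ := hA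
  calc μ B = μ (a +ᵥ B) := (measure_vadd μ a B).symm
    _ ≤ μ (A + B) := measure_mono (Set.vadd_set_subset_add ha)

theorem volume_add_volume_le_of_isCompact {A B : Set ℝ} (hA : IsCompact A) (hB : IsCompact B)
    (hA' : A.Nonempty) (hB' : B.Nonempty) : volume A + volume B ≤ volume (A + B) := by
  obtain ⟨a, haA, ha⟩ := hA.exists_isGreatest hA'
  obtain ⟨b, hbB, hb⟩ := hB.exists_isLeast hB'
  have hinter : volume ((b +ᵥ A) ∩ (a +ᵥ B)) = 0 := by
    refine measure_mono_null (t := {a + b}) ?_ (measure_singleton _)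
    rintro _ ⟨⟨x, hx, rfl⟩, y, hy, hxy⟩
    have hxa := ha hx
    have hby := hb hy
    simp only [vadd_eq_add, Set.mem_singleton_iff] at hxy ⊢
    linarith
  calc volume A + volume B = volume (b +ᵥ A) + volume (a +ᵥ B) := by
        rw [measure_vadd, measure_vadd]
    _ = volume ((b +ᵥ A) ∪ (a +ᵥ B)) := by
        rw [← measure_union_add_inter _ (hB.vadd a).measurableSet, hinter, add_zero]
    _ ≤ volume (A + B) := measure_mono <| Set.union_subset
        (add_comm A B ▸ Set.vadd_set_subset_add hbB) (Set.vadd_set_subset_add haA)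

theorem volume_add_volume_le {A B : Set ℝ} (hA : MeasurableSet A) (hB : MeasurableSet B)
    (hA' : A.Nonempty) (hB' : B.Nonempty) : volume A + volume B ≤ volume (A + B) := by
  simp only [hA.measure_eq_iSup_isCompact, hB.measure_eq_iSup_isCompact, iSup_and']
  refine ENNReal.biSup_add_biSup_le' ⟨∅, A.empty_subset, isCompact_empty⟩
    ⟨∅, B.empty_subset, isCompact_empty⟩ fun K ⟨hKA, hK⟩ L ⟨hLB, hL⟩ => ?_
  rcases K.eq_empty_or_nonempty with rfl | hK'
  · rw [measure_empty, zero_add]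
    exact (measure_mono hLB).trans (measure_le_measure_add hA' B)
  rcases L.eq_empty_or_nonempty with rfl | hL'
  · rw [measure_empty, add_zero, add_comm]
    exact (measure_mono hKA).trans (measure_le_measure_add hB' A)
  exact (volume_add_volume_le_of_isCompact hK hL hK' hL').trans
    (measure_mono (Set.add_subset_add hKA hLB))

theorem mul_volume_add_mul_volume_le {A B : Set ℝ} (hA : MeasurableSet A) (hB : MeasurableSet B)
    (hA' : A.Nonempty) (hB' : B.Nonempty) {s t : ℝ} (hs : 0 ≤ s) (ht : 0 ≤ t) :
    ENNReal.ofReal s * volume A + ENNReal.ofReal t * volume B ≤ volume (s • A + t • B) := by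
  have h := volume_add_volume_le (hA.const_smul₀ s) (hB.const_smul₀ t) hA'.smul_set hB'.smul_set
  simpa only [Measure.addHaar_smul_of_nonneg _ hs, Measure.addHaar_smul_of_nonneg _ ht,
    Module.finrank_self, pow_one] using h

end AddSets

theorem volume_restrict_Ioi_setOf_ofReal_lt (a : ℝ≥0∞) :
    volume.restrict (Set.Ioi (0 : ℝ)) {r | ENNReal.ofReal r < a} = a := by
  rw [Measure.restrict_apply (measurableSet_lt ENNReal.measurable_ofReal measurable_const)]
  induction a with
  | top => simp
  | coe a =>
    have hIoo : {r | ENNReal.ofReal r < a} ∩ Set.Ioi 0 = Set.Ioo 0 (a : ℝ) := by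
      ext r
      simp +contextual [ENNReal.ofReal_lt_coe_iff, and_comm, le_of_lt]
    rw [hIoo, Real.volume_Ioo, sub_zero, ENNReal.ofReal_coe_nnreal]

theorem lintegral_eq_lintegral_measure_ofReal_lt {α : Type*} [MeasurableSpace α] {μ : Measure α}
    [SFinite μ] {f : α → ℝ≥0∞} (hf : Measurable f) :
    ∫⁻ x, f x ∂μ = ∫⁻ r in Set.Ioi (0 : ℝ), μ {x | ENNReal.ofReal r < f x} := by
  have hsubgraph : MeasurableSet {p : α × ℝ | ENNReal.ofReal p.2 < f p.1} :=
    measurableSet_lt (ENNReal.measurable_ofReal.comp measurable_snd) (hf.comp measurable_fst)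
  calc ∫⁻ x, f x ∂μ
      = ∫⁻ x, volume.restrict (Set.Ioi (0 : ℝ)) {r | ENNReal.ofReal r < f x} ∂μ := by
        simp only [volume_restrict_Ioi_setOf_ofReal_lt]
    _ = μ.prod (volume.restrict (Set.Ioi 0)) {p | ENNReal.ofReal p.2 < f p.1} :=
        (Measure.prod_apply hsubgraph).symm
    _ = ∫⁻ r in Set.Ioi (0 : ℝ), μ {x | ENNReal.ofReal r < f x} :=
        Measure.prod_apply_symm hsubgraph

/-- The measure `μ` satisfies the Prékopa–Leindler inequality. -/
def PrekopaLeindler {E : Type*} [AddCommGroup E] [Module ℝ E] [MeasurableSpace E]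
    (μ : Measure E) : Prop :=
  ∀ ⦃s t : ℝ⦄, 0 < s → 0 < t → s + t = 1 → ∀ ⦃f g h : E → ℝ≥0∞⦄,
    Measurable f → Measurable g → Measurable h →
    (∀ x y, f x ^ s * g y ^ t ≤ h (s • x + t • y)) →
    (∫⁻ x, f x ∂μ) ^ s * (∫⁻ x, g x ∂μ) ^ t ≤ ∫⁻ x, h x ∂μ

section Real

variable {s t : ℝ} {f g h : ℝ → ℝ≥0∞}

theorem mul_lintegral_add_mul_lintegral_le_of_iSup_eq (hs : 0 ≤ s) (ht : 0 ≤ t)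
    (hf : Measurable f) (hg : Measurable g) (hh : Measurable h) (hfg : ⨆ x, f x = ⨆ x, g x)
    (hfgh : ∀ x y, min (f x) (g y) ≤ h (s • x + t • y)) :
    ENNReal.ofReal s * (∫⁻ x, f x) + ENNReal.ofReal t * (∫⁻ x, g x) ≤ ∫⁻ x, h x := by
  have hlevel (u : ℝ → ℝ≥0∞) : Measurable fun r : ℝ => volume {x | ENNReal.ofReal r < u x} :=
    Antitone.measurable fun r r' hr => measure_mono fun x (hx : ENNReal.ofReal r' < u x) =>
      (ENNReal.ofReal_le_ofReal hr).trans_lt hx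
  rw [lintegral_eq_lintegral_measure_ofReal_lt hf, lintegral_eq_lintegral_measure_ofReal_lt hg,
    lintegral_eq_lintegral_measure_ofReal_lt hh, ← lintegral_const_mul _ (hlevel f),
    ← lintegral_const_mul _ (hlevel g), ← lintegral_add_left ((hlevel f).const_mul _)]
  refine lintegral_mono fun r => ?_
  have hempty {u : ℝ → ℝ≥0∞} (hr : ⨆ x, u x ≤ ENNReal.ofReal r) :
      {x | ENNReal.ofReal r < u x} = ∅ :=
    Set.eq_empty_of_forall_notMem fun x hx => ((le_iSup u x).trans hr).not_gt hx
  rcases lt_or_ge (ENNReal.ofReal r) (⨆ x, f x) with hr | hr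
  · refine (mul_volume_add_mul_volume_le (hf measurableSet_Ioi) (hg measurableSet_Ioi)
      (lt_iSup_iff.1 hr) (lt_iSup_iff.1 (hr.trans_eq hfg)) hs ht).trans (measure_mono ?_)
    rintro _ ⟨_, ⟨x, hx, rfl⟩, _, ⟨y, hy, rfl⟩, rfl⟩
    exact (lt_min hx hy).trans_le (hfgh x y)
  · simp [hempty hr, hempty (hfg ▸ hr)]

theorem lintegral_rpow_mul_lintegral_rpow_le_of_iSup_ne_top (hs : 0 < s) (ht : 0 < t)
    (hst : s + t = 1) (hf : Measurable f) (hg : Measurable g) (hh : Measurable h)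
    (hf' : ⨆ x, f x ≠ ∞) (hg' : ⨆ x, g x ≠ ∞)
    (hfgh : ∀ x y, f x ^ s * g y ^ t ≤ h (s • x + t • y)) :
    (∫⁻ x, f x) ^ s * (∫⁻ x, g x) ^ t ≤ ∫⁻ x, h x := by
  set a := ⨆ x, f x
  set b := ⨆ x, g x
  rcases eq_or_ne a 0 with ha | ha
  · simp [ENNReal.iSup_eq_zero.1 ha, hs]
  rcases eq_or_ne b 0 with hb | hb
  · simp [ENNReal.iSup_eq_zero.1 hb, ht]
  have hab : a⁻¹ ^ s * b⁻¹ ^ t ≠ 0 := by simp [ha, hb, hf', hg']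
  have hab' : a⁻¹ ^ s * b⁻¹ ^ t ≠ ∞ := by finiteness
  have hmul (u v : ℝ≥0∞) :
      (a⁻¹ * u) ^ s * (b⁻¹ * v) ^ t = a⁻¹ ^ s * b⁻¹ ^ t * (u ^ s * v ^ t) := by
    rw [ENNReal.mul_rpow_of_nonneg _ _ hs.le, ENNReal.mul_rpow_of_nonneg _ _ ht.le,
      mul_mul_mul_comm]
  have hnormalized : ENNReal.ofReal s * (∫⁻ x, a⁻¹ * f x) + ENNReal.ofReal t * (∫⁻ x, b⁻¹ * g x) ≤
      ∫⁻ x, a⁻¹ ^ s * b⁻¹ ^ t * h x := by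
    refine mul_lintegral_add_mul_lintegral_le_of_iSup_eq hs.le ht.le (hf.const_mul _)
      (hg.const_mul _) (hh.const_mul _) ?_ fun x y =>
        (min_le_rpow_mul_rpow hs.le ht.le hst _ _).trans ?_
    · rw [← ENNReal.mul_iSup, ← ENNReal.mul_iSup, ENNReal.inv_mul_cancel ha hf',
        ENNReal.inv_mul_cancel hb hg']
    · rw [hmul]
      gcongr
      exact hfgh x y
  rw [lintegral_const_mul _ hf, lintegral_const_mul _ hg, lintegral_const_mul _ hh] at hnormalized
  rw [← ENNReal.mul_le_mul_iff_right hab hab', ← hmul]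
  exact (rpow_mul_rpow_le_add hs ht hst _ _).trans hnormalized

theorem tendsto_lintegral_min_natCast {α : Type*} [MeasurableSpace α] {μ : Measure α}
    {u : α → ℝ≥0∞} (hu : Measurable u) :
    Filter.Tendsto (fun n : ℕ => ∫⁻ x, min (u x) n ∂μ) Filter.atTop (nhds (∫⁻ x, u x ∂μ)) := by
  refine lintegral_tendsto_of_tendsto_of_monotone
    (fun n => (hu.min measurable_const).aemeasurable)
    (Filter.Eventually.of_forall fun x m n hmn => min_le_min_left _ (by exact_mod_cast hmn))
    (Filter.Eventually.of_forall fun x => ?_)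
  simpa using tendsto_const_nhds (x := u x) |>.min ENNReal.tendsto_nat_nhds_top

theorem prekopaLeindler_real : PrekopaLeindler (volume : Measure ℝ) := by
  intro s t hs ht hst f g h hf hg hh hfgh
  rcases eq_or_ne (∫⁻ x, f x) 0 with hf₀ | hf₀
  · simp [hf₀, hs]
  rcases eq_or_ne (∫⁻ x, g x) 0 with hg₀ | hg₀
  · simp [hg₀, ht]
  have htendsto := ENNReal.Tendsto.mul
    ((tendsto_lintegral_min_natCast (μ := volume) hf).ennrpow_const s)
    (Or.inl (by simp [hf₀, hs.le]))
    ((tendsto_lintegral_min_natCast (μ := volume) hg).ennrpow_const t)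
    (Or.inl (by simp [hg₀, ht.le]))
  refine le_of_tendsto' htendsto fun n => ?_
  have hbounded (u : ℝ → ℝ≥0∞) : ⨆ x, min (u x) (n : ℝ≥0∞) ≠ ∞ :=
    ne_top_of_le_ne_top (ENNReal.natCast_ne_top n) (iSup_le fun x => min_le_right _ _)
  refine lintegral_rpow_mul_lintegral_rpow_le_of_iSup_ne_top hs ht hst (hf.min measurable_const)
    (hg.min measurable_const) hh (hbounded f) (hbounded g) fun x y => le_trans ?_ (hfgh x y)
  gcongr <;> exact min_le_left _ _

end Real

namespace PrekopaLeindler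

variable {E F : Type*} [AddCommGroup E] [Module ℝ E] [MeasurableSpace E]
  [AddCommGroup F] [Module ℝ F] [MeasurableSpace F] {μ : Measure E} {ν : Measure F}

theorem of_subsingleton [Subsingleton E] : PrekopaLeindler μ := by
  intro s t hs ht hst f g h _ _ _ hfgh
  have : Unique E := uniqueOfSubsingleton 0
  simp only [lintegral_unique, ENNReal.mul_rpow_of_nonneg _ _ hs.le,
    ENNReal.mul_rpow_of_nonneg _ _ ht.le]
  rw [mul_mul_mul_comm, ← ENNReal.rpow_add_of_nonneg _ _ hs.le ht.le, hst, ENNReal.rpow_one]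
  gcongr
  simpa only [Subsingleton.elim _ (default : E)] using hfgh default default

theorem smul (hμ : PrekopaLeindler μ) (c : ℝ≥0∞) : PrekopaLeindler (c • μ) := by
  intro s t hs ht hst f g h hf hg hh hfgh
  simp only [lintegral_smul_measure, smul_eq_mul, ENNReal.mul_rpow_of_nonneg _ _ hs.le,
    ENNReal.mul_rpow_of_nonneg _ _ ht.le]
  rw [mul_mul_mul_comm, ← ENNReal.rpow_add_of_nonneg _ _ hs.le ht.le, hst, ENNReal.rpow_one]
  gcongr
  exact hμ hs ht hst hf hg hh hfgh

theorem map (hμ : PrekopaLeindler μ) (L : E →ₗ[ℝ] F) (hL : Measurable L) :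
    PrekopaLeindler (μ.map L) := by
  intro s t hs ht hst f g h hf hg hh hfgh
  simp only [lintegral_map hf hL, lintegral_map hg hL, lintegral_map hh hL]
  refine hμ hs ht hst (hf.comp hL) (hg.comp hL) (hh.comp hL) fun x y => ?_
  simpa only [Function.comp_apply, map_add, map_smul] using hfgh (L x) (L y)

theorem prod [SFinite ν] (hμ : PrekopaLeindler μ) (hν : PrekopaLeindler ν) :
    PrekopaLeindler (μ.prod ν) := by
  intro s t hs ht hst f g h hf hg hh hfgh
  rw [lintegral_prod _ hf.aemeasurable, lintegral_prod _ hg.aemeasurable,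
    lintegral_prod _ hh.aemeasurable]
  refine hμ hs ht hst hf.lintegral_prod_right' hg.lintegral_prod_right' hh.lintegral_prod_right'
    fun x y => ?_
  exact hν hs ht hst (hf.comp measurable_prodMk_left) (hg.comp measurable_prodMk_left)
    (hh.comp measurable_prodMk_left) fun v w => hfgh (x, v) (y, w)

theorem measure_rpow_mul_measure_rpow_le (hμ : PrekopaLeindler μ) {s t : ℝ} (hs : 0 < s)
    (ht : 0 < t) (hst : s + t = 1) {A B C : Set E} (hA : MeasurableSet A) (hB : MeasurableSet B)
    (hC : ∀ x ∈ A, ∀ y ∈ B, s • x + t • y ∈ C) : μ A ^ s * μ B ^ t ≤ μ C := by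
  have hCm := measurableSet_toMeasurable μ C
  have h := hμ hs ht hst (measurable_one.indicator hA) (measurable_one.indicator hB)
    (measurable_one.indicator hCm) fun x y => ?_
  · rwa [lintegral_indicator_one hA, lintegral_indicator_one hB, lintegral_indicator_one hCm,
      measure_toMeasurable] at h
  by_cases hx : x ∈ A
  · by_cases hy : y ∈ B
    · simp [hx, hy, subset_toMeasurable μ C (hC x hx y hy)]
    · simp [hy, ht]
  · simp [hx, hs]

end PrekopaLeindler

section AddHaar

variable {E : Type*} [NormedAddCommGroup E] [NormedSpace ℝ E] [FiniteDimensional ℝ E]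
  [MeasurableSpace E] [BorelSpace E] (μ : Measure E) [μ.IsAddHaarMeasure]

variable {μ} in
theorem PrekopaLeindler.of_continuousLinearEquiv {F : Type*} [NormedAddCommGroup F]
    [NormedSpace ℝ F] [MeasurableSpace F] [BorelSpace F] {ν : Measure F} [ν.IsAddHaarMeasure]
    (hν : PrekopaLeindler ν) (e : F ≃L[ℝ] E) : PrekopaLeindler μ := by
  rw [Measure.isAddLeftInvariant_eq_smul μ (ν.map e)]
  exact (hν.map e.toLinearMap e.continuous.measurable).smul _

theorem prekopaLeindler_pi (d : ℕ) : PrekopaLeindler (volume : Measure (Fin d → ℝ)) := by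
  induction d with
  | zero => exact .of_subsingleton
  | succ d ih =>
    exact (prekopaLeindler_real.prod ih).of_continuousLinearEquiv
      (Fin.consEquivL ℝ fun _ : Fin (d + 1) => ℝ)

theorem prekopaLeindler_of_isAddHaarMeasure : PrekopaLeindler μ :=
  (prekopaLeindler_pi (Module.finrank ℝ E)).of_continuousLinearEquiv
    (ContinuousLinearEquiv.ofFinrankEq (Module.finrank_fin_fun ℝ))

open scoped Pointwise

theorem brunnMinkowski [Nontrivial E] {A B : Set E} (hA : MeasurableSet A)
    (hB : MeasurableSet B) (hA' : A.Nonempty) (hB' : B.Nonempty) :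
    μ A ^ (Module.finrank ℝ E : ℝ)⁻¹ + μ B ^ (Module.finrank ℝ E : ℝ)⁻¹ ≤
      μ (A + B) ^ (Module.finrank ℝ E : ℝ)⁻¹ := by
  have hd : (0 : ℝ) < Module.finrank ℝ E := Nat.cast_pos.2 Module.finrank_pos
  refine add_le_map_add_of_homogeneous_of_logConcave
    (Φ := fun S : Set E => μ S ^ (Module.finrank ℝ E : ℝ)⁻¹) (fun c _ S => ?_) ?_ ?_
    fun s t hs ht hst c d => ?_
  · rw [Measure.addHaar_nnreal_smul, ENNReal.mul_rpow_of_nonneg _ _ (inv_nonneg.2 hd.le),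
      ← ENNReal.rpow_natCast, ENNReal.rpow_rpow_inv hd.ne']
  · exact ENNReal.rpow_le_rpow (add_comm A B ▸ measure_le_measure_add hB' A) (inv_nonneg.2 hd.le)
  · exact ENNReal.rpow_le_rpow (measure_le_measure_add hA' B) (inv_nonneg.2 hd.le)
  · rw [← ENNReal.rpow_mul, ← ENNReal.rpow_mul, mul_comm _ (s : ℝ), mul_comm _ (t : ℝ),
      ENNReal.rpow_mul, ENNReal.rpow_mul, ← ENNReal.mul_rpow_of_nonneg _ _ (inv_nonneg.2 hd.le)]
    gcongr
    exact (prekopaLeindler_of_isAddHaarMeasure μ).measure_rpow_mul_measure_rpow_le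
      (NNReal.coe_pos.2 hs.bot_lt) (NNReal.coe_pos.2 ht.bot_lt) (by exact_mod_cast hst)
      (hA.const_smul₀ c) (hB.const_smul₀ d) fun x hx y hy =>
        Set.add_mem_add (Set.smul_mem_smul_set hx) (Set.smul_mem_smul_set hy)

end AddHaar

theorem upperSemicontinuous_measure_image {X Y Z : Type*} [TopologicalSpace X]
    [TopologicalSpace Y] [TopologicalSpace Z] [MeasurableSpace Z] {μ : Measure Z}
    [μ.OuterRegular] {F : X → Y → Z} (hF : Continuous (Function.uncurry F)) {K : Set Y}
    (hK : IsCompact K) : UpperSemicontinuous fun x => μ (F x '' K) := by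
  intro x c hc
  obtain ⟨V, hKV, hV, hVc⟩ := Set.exists_isOpen_lt_of_lt _ _ hc
  have hmaps : ∀ᶠ x' in nhds x, ∀ y ∈ K, F x' y ∈ V :=
    hK.eventually_forall_of_forall_eventually fun y hy =>
      hF.continuousAt.eventually_mem (hV.mem_nhds (hKV ⟨y, hy, rfl⟩))
  filter_upwards [hmaps] with x' hx'
  exact (measure_mono (Set.image_subset_iff.2 hx')).trans_lt hVc

section Projection

open scoped Pointwise

variable {n j : ℕ}

theorem Gr.upperSemicontinuous_of_rotate {β : Type*} [Preorder β] {f : Gr n j → β}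
    (hf : ∀ ξ, UpperSemicontinuous fun g => f (Gr.rotate g ξ)) : UpperSemicontinuous f :=
  upperSemicontinuous_iff_isOpen_preimage.2 fun c => isOpen_iSup_iff.2 fun ξ =>
    isOpen_coinduced.2 (upperSemicontinuous_iff_isOpen_preimage.1 (hf ξ) c)

instance Gr.isProbabilityMeasure_haar (h : j ≤ n) : IsProbabilityMeasure (Gr.haar h) :=
  have : IsProbabilityMeasure (orthHaar n) :=
    ⟨Measure.haarMeasure_self (K₀ := (⊤ : TopologicalSpace.PositiveCompacts (OrthGroup n)))⟩
  Measure.isProbabilityMeasure_map (Gr.continuous_rotate _).measurable.aemeasurable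

theorem projVol_rotate (K : ConvexBody (Euc n)) (g : OrthGroup n) (ξ : Gr n j) :
    projVol K (Gr.rotate g ξ) = volume ((fun x => ξ.space.orthogonalProjectionOnto
      ((star g : OrthGroup n).val x)) '' (K : Set (Euc n))) := by
  let φ : ξ.space ≃ₗᵢ[ℝ] (Gr.rotate g ξ).space :=
    (Unitary.linearIsometryEquiv g).submoduleMap ξ.space
  have hφ (x : Euc n) : (Gr.rotate g ξ).space.orthogonalProjectionOnto x =
      φ (ξ.space.orthogonalProjectionOnto ((star g : OrthGroup n).val x)) :=
    Subtype.ext (Submodule.starProjection_map_apply (Unitary.linearIsometryEquiv g) ξ.space x)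
  have hvolume (S : Set ξ.space) : volume (φ '' S) = volume S := by
    rw [φ.image_eq_preimage_symm]
    exact φ.symm.measurePreserving.measure_preimage_equiv (f := φ.symm.toMeasurableEquiv) S
  rw [projVol, ← hvolume, Set.image_image]
  simp only [hφ]

theorem measurable_projVol (K : ConvexBody (Euc n)) :
    Measurable (projVol K : Gr n j → ℝ≥0∞) := by
  refine (Gr.upperSemicontinuous_of_rotate fun ξ => ?_).measurable
  simp only [projVol_rotate]
  refine upperSemicontinuous_measure_image ?_ K.isCompact
  have hstar : Continuous fun p : OrthGroup n × Euc n => (star p.1 : OrthGroup n).val :=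
    (continuous_star.comp continuous_subtype_val).comp continuous_fst
  exact ξ.space.orthogonalProjectionOnto.continuous.comp (hstar.clm_apply continuous_snd)

theorem projVol_ne_top (K : ConvexBody (Euc n)) (ξ : Gr n j) : projVol K ξ ≠ ∞ :=
  (K.isCompact.image ξ.space.orthogonalProjectionOnto.continuous).measure_ne_top

theorem projVol_smul (K : ConvexBody (Euc n)) {ε : ℝ} (hε : 0 ≤ ε) (ξ : Gr n j) :
    projVol (ε • K) ξ = ENNReal.ofReal ε ^ j * projVol K ξ := by
  rw [projVol, ConvexBody.coe_smul, image_smul_set, Measure.addHaar_smul_of_nonneg _ hε,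
    ξ.finrank_eq, ENNReal.ofReal_pow hε, projVol]

theorem projVol_add (hj : 0 < j) (K L : ConvexBody (Euc n)) (ξ : Gr n j) :
    projVol K ξ ^ (j : ℝ)⁻¹ + projVol L ξ ^ (j : ℝ)⁻¹ ≤ projVol (K + L) ξ ^ (j : ℝ)⁻¹ := by
  have : Nontrivial ξ.space := Module.finrank_pos_iff.1 (hj.trans_eq ξ.finrank_eq.symm)
  have hproj := ξ.space.orthogonalProjectionOnto.continuous
  have h := brunnMinkowski volume (K.isCompact.image hproj).measurableSet
    (L.isCompact.image hproj).measurableSet (K.nonempty.image _) (L.nonempty.image _)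
  rwa [← Set.image_add, ξ.finrank_eq] at h

theorem ballVol_ne_zero (j : ℕ) : ballVol j ≠ 0 :=
  (Metric.measure_closedBall_pos volume _ one_pos).ne'

theorem ballVol_ne_top (j : ℕ) : ballVol j ≠ ∞ :=
  measure_closedBall_lt_top.ne

/-- The affine quermassintegral `Φ_{n-j}(K)` for `0 < j ≤ n`, with values in `[0, ∞]`. For `j < n`
it is `ω_n` times the `L^{-n}` mean of `vol_j(K|ξ) / ω_j`. -/
noncomputable def eaffineQuermass (j : ℕ) (K : ConvexBody (Euc n)) : ℝ≥0∞ :=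
  if h : j < n then
    ballVol n * eLpNorm' (fun ξ : Gr n j => projVol K ξ / ballVol j) (-n) (Gr.haar h.le)
  else volume (K : Set (Euc n))

theorem affineQuermass_eq_toReal (hj : 0 < j) (K : ConvexBody (Euc n)) :
    affineQuermass j K = (eaffineQuermass j K).toReal := by
  by_cases h : j < n
  · simp [affineQuermass, eaffineQuermass, eLpNorm', hj.ne', h]
  · simp [affineQuermass, eaffineQuermass, hj.ne', h]

theorem eaffineQuermass_ne_top (K : ConvexBody (Euc n)) : eaffineQuermass j K ≠ ∞ := by
  unfold eaffineQuermass
  split_ifs with h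
  · have hn : -(n : ℝ) < 0 := neg_neg_of_pos (Nat.cast_pos.2 (j.zero_le.trans_lt h))
    exact ENNReal.mul_ne_top (ballVol_ne_top n) <| eLpNorm'_ne_top_of_neg hn
      ((measurable_projVol K).div_const _)
      fun ξ => ENNReal.div_ne_top (projVol_ne_top K ξ) (ballVol_ne_zero j)
  · exact K.isCompact.measure_ne_top

theorem eaffineQuermass_smul (hjn : j ≤ n) (K : ConvexBody (Euc n)) {ε : ℝ} (hε : 0 < ε) :
    eaffineQuermass j (ε • K) = ENNReal.ofReal ε ^ j * eaffineQuermass j K := by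
  unfold eaffineQuermass
  split_ifs with h
  · have hn : -(n : ℝ) < 0 := neg_neg_of_pos (Nat.cast_pos.2 (j.zero_le.trans_lt h))
    simp only [projVol_smul K hε.le, mul_div_assoc]
    rw [eLpNorm'_const_mul_of_neg hn (by simp [hε]) (by finiteness), mul_left_comm]
  · obtain rfl := hjn.antisymm (not_lt.1 h)
    rw [ConvexBody.coe_smul, Measure.addHaar_smul_of_nonneg _ hε.le, finrank_euclideanSpace_fin,
      ENNReal.ofReal_pow hε.le]

theorem eaffineQuermass_add (hj : 0 < j) (hjn : j ≤ n) (K L : ConvexBody (Euc n)) :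
    eaffineQuermass j K ^ (j : ℝ)⁻¹ + eaffineQuermass j L ^ (j : ℝ)⁻¹ ≤
      eaffineQuermass j (K + L) ^ (j : ℝ)⁻¹ := by
  have hj' : (0 : ℝ) < j := Nat.cast_pos.2 hj
  unfold eaffineQuermass
  split_ifs with h
  · have hn : -(n : ℝ) < 0 := neg_neg_of_pos (Nat.cast_pos.2 (hj.trans h))
    simp only [ENNReal.mul_rpow_of_nonneg _ _ (inv_nonneg.2 hj'.le), ← mul_add]
    gcongr
    refine eLpNorm'_rpow_inv_add_le_of_neg hn ((measurable_projVol K).div_const _)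
      ((measurable_projVol L).div_const _) hj' fun ξ => ?_
    simp only [ENNReal.div_rpow_of_nonneg _ _ (inv_nonneg.2 hj'.le), ← ENNReal.add_div]
    gcongr
    exact projVol_add hj K L ξ
  · obtain rfl := hjn.antisymm (not_lt.1 h)
    have : Nonempty (Fin j) := ⟨⟨0, hj⟩⟩
    simpa only [finrank_euclideanSpace_fin, ConvexBody.coe_add] using brunnMinkowski volume
      K.isCompact.measurableSet L.isCompact.measurableSet K.nonempty L.nonempty

end Projection

theorem theorem2p3_general (n j : ℕ) (hj : 0 < j) (hjn : j ≤ n)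
    (K L : ConvexBody (EuclideanSpace ℝ (Fin n))) (ε : ℝ) (hε : 0 < ε) :
    affineQuermass j (K + ε • L) ^ (1 / (j : ℝ)) ≥
      affineQuermass j K ^ (1 / (j : ℝ)) + ε * affineQuermass j L ^ (1 / (j : ℝ)) := by
  have hfin (M : ConvexBody (Euc n)) : eaffineQuermass j M ^ (j : ℝ)⁻¹ ≠ ∞ :=
    ENNReal.rpow_ne_top_of_nonneg (by positivity) (eaffineQuermass_ne_top M)
  have hhomogeneous :
      eaffineQuermass j (ε • L) ^ (j : ℝ)⁻¹ =
        ENNReal.ofReal ε * eaffineQuermass j L ^ (j : ℝ)⁻¹ := by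
    rw [eaffineQuermass_smul hjn L hε, ENNReal.mul_rpow_of_nonneg _ _ (by positivity),
      ENNReal.pow_rpow_inv_natCast hj.ne']
  have hadd := ENNReal.toReal_mono (hfin _) (eaffineQuermass_add hj hjn K (ε • L))
  rw [ENNReal.toReal_add (hfin _) (hfin _), hhomogeneous, ENNReal.toReal_mul,
    ENNReal.toReal_ofReal hε.le] at hadd
  simpa only [affineQuermass_eq_toReal hj, one_div, ENNReal.toReal_rpow] using hadd

/-- The Brunn–Minkowski inequality for affine quermassintegrals. -/
theorem theorem2p3 (n j : ℕ) (hj : 0 < j) (hjn : j ≤ n)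
    (K L : ConvexBody (EuclideanSpace ℝ (Fin n))) (hK : 0 ∈ K) (hL : 0 ∈ L)
    (ε : ℝ) (hε : 0 < ε) :
    affineQuermass j (K + ε • L) ^ (1 / (j : ℝ)) ≥
      affineQuermass j K ^ (1 / (j : ℝ)) + ε * affineQuermass j L ^ (1 / (j : ℝ)) :=
  theorem2p3_general n j hj hjn K L ε hε
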